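/- Let $G$ be a finitely generated group with a finite symmetric generating set $S$, and let $|x|$ denote the word length of $x\in G$ with respect to $S$. For $u\in G$ and $f:G\to\mathbb{C}$ put $\partial_u f(x)=f(ux)-f(x)$. For an integer $k\ge 0$ let $P^k(G)$ be the space of all $f:G\to\mathbb{C}$ such that $\partial_{u_1}\cdots\partial_{u_{k+1}}f=0$ for all $u_1,\dots,u_{k+1}\in G$, and let $P^k(G)=\{0\}$ for $k<0$. Let $\mu$ be a probability measure on $G$ which is symmetric ($\mu(x)=\mu(x^{-1})$ for all $x$), whose support generates $G$, which has an exponential tail (there is $\varepsilon>0$ with $\mu(x)\le e^{-\varepsilon|x|}$ for all $x\in G$), and for which $\sum_{s\in G}\mu(s)|s|^n<\infty$ for every integer $n\ge 0$ (a consequence of the exponential tail if $G$ has subexponential growth). Write $\Delta_\mu f(x)=\sum_{s\in G}\mu(s)\,(f(x)-f(xs))$. Then for every integer $k\ge 0$ the sum defining $\Delta_\mu f(x)$ converges absolutely for all $f\in P^k(G)$ and $x\in G$, and $\Delta_\mu P^k(G)\subseteq P^{k-2}(G)$. If moreover $k\le 1$ or the abelianization $G/[G,G]$ is infinite (equivalently,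 $G$ carries a non-constant polynomial), then $$\Delta_\mu P^k(G)=P^{k-2}(G).$$ -/

import Mathlib

/-- `S` is a finite symmetric generating set of the group `G`. -/
structure IsSymmGeneratingSet {G : Type*} [Group G] (S : Finset G) : Prop where
  inv_mem_iff : ∀ s : G, s⁻¹ ∈ S ↔ s ∈ S
  closure_eq_top : Subgroup.closure (S : Set G) = ⊤

/-- The word length `|x|` of `x` with respect to `S`: the least `n` such that `x` is a product
of `n` elements of `S`. (The set is nonempty when `S` is a symmetric generating set.) -/
noncomputable def wordLength {G : Type*} [Group G] (S : Finset G) (x : G) : ℕ :=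
  sInf {n : ℕ | ∃ l : List G, l.length = n ∧ (∀ s ∈ l, s ∈ S) ∧ l.prod = x}

/-- The standing assumptions on a probability measure `μ` on the (countable, discrete) group `G`,
with word length taken with respect to `S`. -/
structure StandingAssumptions {G : Type*} [Group G] (S : Finset G) (μ : PMF G) : Prop where
  symmetric : ∀ x : G, μ x⁻¹ = μ x
  adapted : Subgroup.closure μ.support = ⊤
  exponential_tail : ∃ ε : ℝ, 0 < ε ∧
    ∀ x : G, (μ x).toReal ≤ Real.exp (-(ε * (wordLength S x : ℝ)))
  /-- Finiteness of all moments. When `G` has subexponential growth this follows from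
  `exponential_tail`; on a group of exponential growth it does not, and it is what makes the
  Laplacian well defined on functions of polynomial growth. -/
  finite_moments : ∀ n : ℕ, Summable fun s : G => (μ s).toReal * (wordLength S s : ℝ) ^ n

/-- The left derivative `∂_u f (x) = f (u x) - f x`, as a linear operator on functions. -/
def leftDeriv {G : Type*} [Group G] (u : G) : Module.End ℂ (G → ℂ) where
  toFun f := fun x => f (u * x) - f x
  map_add' f g := by
    funext x
    simp only [Pi.add_apply]
    ring
  map_smul' c f := by
    funext x
    simp only [Pi.smul_apply, smul_eq_mul, RingHom.id_apply]
    ring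

/-- `P^k(G)`: for `k ≥ 0`, the functions `f` with `∂_{u_1} ⋯ ∂_{u_{k+1}} f = 0` for all
`u_1, …, u_{k+1} ∈ G`; for `k < 0`, the zero space. -/
def polySpace (G : Type*) [Group G] : ℤ → Submodule ℂ (G → ℂ)
  | Int.ofNat k =>
    { carrier := {f | ∀ u : List G, u.length = k + 1 → (u.map leftDeriv).prod f = 0}
      zero_mem' := fun u _ => map_zero _
      add_mem' := fun {f g} hf hg u hu => by rw [map_add, hf u hu, hg u hu, add_zero]
      smul_mem' := fun c f hf u hu => by rw [map_smul, hf u hu, smul_zero] }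
  | Int.negSucc _ => ⊥

/-- The Laplacian `Δ_μ f (x) = ∑_s μ(s) (f x - f (x s))`. -/
noncomputable def laplacian {G : Type*} [Group G] (μ : PMF G) (f : G → ℂ) : G → ℂ :=
  fun x => ∑' s : G, ((μ s).toReal : ℂ) * (f x - f (x * s))

/-!
Two elementary inductions suffice; no coordinates on nilpotent quotients of `G` are needed.

Write `Q n` for `P^{n-1}(G)` (`polyBelow`), so that `Q 0 = 0` and `f ∈ Q (n + 1)` iff all
`∂_u f ∈ Q n`. A weighted average over right translates, `f ↦ ∑ s, w s * f (x * s)`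
(`rightAverage`), commutes with the *left* derivatives, hence on `Q (n + 1)` it agrees with
multiplication by the total mass `∑ w` up to an element of `Q n`
(`rightAverage_sub_mass_smul_mem`). The series converge since polynomials have polynomial growth
and `μ` has finite moments. With the symmetry of `μ`, which annihilates the homomorphism
`f - f 1` for `f ∈ P^1`, the same induction shows that the Laplacian lowers the degree by two
(`laplacian_mem_polyBelow`).

For surjectivity, fix a nonzero homomorphism `φ : G → ℤ`, which exists because the finitely
generated abelian group `G/[G,G]` is infinite. Expanding `φ (x s) ^ (d + 2)`,
`Δ (φ ^ (d + 2) f) = φ ^ (d + 2) Δ f - (d + 2) φ ^ (d + 1) M₁ f - (d + 2 choose 2) φ ^ d M₂ f - ⋯`,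
where `M_j` is the average with weight `μ φ ^ j`. The mass of `μ φ` is `0` by symmetry, and the
mass of `μ φ ^ 2` is a positive number because the support of `μ` generates `G`. So modulo terms
divisible by `φ ^ (d + 1)` and terms of lower total degree, the right-hand side is a nonzero
multiple of `φ ^ d f`. Induction on the degree, and for a given degree downward induction on `d`,
places `φ ^ d f` in the image of the Laplacian (`pow_mul_mem_laplacianImage`); `d = 0` is the claim.
-/

/-! ### Polynomials, indexed from the zero space -/

/-- The space `P^{n-1}(G)`, defined recursively: `polyBelow G 0` is zero, and `polyBelow G (n + 1)`
consists of the functions all of whose left derivatives lie in `polyBelow G n`. The shift of the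
index makes `n = 0` the common starting point of all inductions. -/
def polyBelow (G : Type*) [Group G] : ℕ → Submodule ℂ (G → ℂ)
  | 0 => ⊥
  | n + 1 => ⨅ u : G, (polyBelow G n).comap (leftDeriv u)

section Polynomials

variable {G : Type*} [Group G]

@[simp]
theorem leftDeriv_apply (u : G) (f : G → ℂ) (x : G) : leftDeriv u f x = f (u * x) - f x := rfl

theorem mem_polyBelow_zero {f : G → ℂ} : f ∈ polyBelow G 0 ↔ f = 0 := Iff.rfl

theorem mem_polyBelow_succ {n : ℕ} {f : G → ℂ} :
    f ∈ polyBelow G (n + 1) ↔ ∀ u : G, leftDeriv u f ∈ polyBelow G n := by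
  simp [polyBelow]

theorem mem_polyBelow_iff_forall_list (n : ℕ) (f : G → ℂ) :
    f ∈ polyBelow G n ↔ ∀ u : List G, u.length = n → (u.map leftDeriv).prod f = 0 := by
  induction n generalizing f with
  | zero => simp [mem_polyBelow_zero]
  | succ n ih =>
    rw [mem_polyBelow_succ]
    constructor
    · intro h u hu
      -- the factor acting first on `f` is the last entry of the list
      obtain rfl | ⟨l, a, rfl⟩ := u.eq_nil_or_concat
      · simp at hu
      · have := (ih _).1 (h a) l (by simpa using hu)
        simpa using this
    · intro h a
      rw [ih]
      intro l hl
      simpa using h (l ++ [a]) (by simp [hl])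

theorem polySpace_natCast (k : ℕ) : polySpace G (k : ℤ) = polyBelow G (k + 1) := by
  ext f
  rw [mem_polyBelow_iff_forall_list]
  rfl

theorem polyBelow_le_succ (n : ℕ) : polyBelow G n ≤ polyBelow G (n + 1) := by
  induction n with
  | zero => exact bot_le
  | succ n ih =>
    intro f hf
    exact mem_polyBelow_succ.2 fun u => ih (mem_polyBelow_succ.1 hf u)

theorem polyBelow_mono : Monotone (polyBelow G) := monotone_nat_of_le_succ polyBelow_le_succ

theorem leftDeriv_mem_polyBelow {n : ℕ} {f : G → ℂ} (hf : f ∈ polyBelow G n) (u : G) :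
    leftDeriv u f ∈ polyBelow G n :=
  mem_polyBelow_succ.1 (polyBelow_le_succ n hf) u

theorem leftTranslate_mem_polyBelow {n : ℕ} {f : G → ℂ} (hf : f ∈ polyBelow G n) (u : G) :
    (fun x => f (u * x)) ∈ polyBelow G n := by
  have h : (fun x => f (u * x)) = leftDeriv u f + f := by
    funext x
    simp
  rw [h]
  exact add_mem (leftDeriv_mem_polyBelow hf u) hf

theorem eq_apply_one_of_mem_polyBelow_one {f : G → ℂ} (hf : f ∈ polyBelow G 1) (x : G) :
    f x = f 1 := by
  have h := congrFun (mem_polyBelow_zero.1 (mem_polyBelow_succ.1 hf x)) 1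
  simpa [sub_eq_zero] using h

theorem mem_polyBelow_one_of_const {f : G → ℂ} (hf : ∀ x, f x = f 1) : f ∈ polyBelow G 1 := by
  refine mem_polyBelow_succ.2 fun u => mem_polyBelow_zero.2 ?_
  funext x
  simp [hf (u * x), hf x]

/-- A polynomial of degree one is a constant plus a homomorphism, hence odd up to a constant. -/
theorem apply_inv_sub_of_mem_polyBelow_two {f : G → ℂ} (hf : f ∈ polyBelow G 2) (s : G) :
    f 1 - f s⁻¹ = -(f 1 - f s) := by
  have h := eq_apply_one_of_mem_polyBelow_one (mem_polyBelow_succ.1 hf s) s⁻¹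
  simp only [leftDeriv_apply, mul_inv_cancel, mul_one] at h
  linear_combination h

/-- Multiplication by a homomorphism raises the degree by at most one. -/
theorem hom_mul_mem_polyBelow {φ : G → ℂ} (hφ : ∀ x y, φ (x * y) = φ x + φ y) {n : ℕ}
    {f : G → ℂ} (hf : f ∈ polyBelow G n) : φ * f ∈ polyBelow G (n + 1) := by
  induction n generalizing f with
  | zero =>
    rw [mem_polyBelow_zero.1 hf, mul_zero]
    exact zero_mem _
  | succ n ih =>
    refine mem_polyBelow_succ.2 fun u => ?_
    have h : leftDeriv u (φ * f) = φ * leftDeriv u f + φ u • fun x => f (u * x) := by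
      funext x
      simp [hφ]
      ring
    rw [h]
    exact add_mem (ih (mem_polyBelow_succ.1 hf u))
      (Submodule.smul_mem _ _ (leftTranslate_mem_polyBelow hf u))

theorem hom_pow_mul_mem_polyBelow {φ : G → ℂ} (hφ : ∀ x y, φ (x * y) = φ x + φ y) {n : ℕ}
    {f : G → ℂ} (hf : f ∈ polyBelow G n) (m : ℕ) : φ ^ m * f ∈ polyBelow G (n + m) := by
  induction m with
  | zero => simpa using hf
  | succ m ih =>
    rw [pow_succ', mul_assoc]
    exact hom_mul_mem_polyBelow hφ ih

end Polynomials

/-! ### Growth of polynomials and convergence -/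

section Growth

variable {G : Type*} [Group G]

theorem exists_bound_list_of_mem_polyBelow (S : Finset G) (n : ℕ) {f : G → ℂ}
    (hf : f ∈ polyBelow G n) :
    ∃ C : ℝ, 0 ≤ C ∧ ∀ l : List G, (∀ s ∈ l, s ∈ S) →
      ‖f l.prod‖ ≤ C * (1 + (l.length : ℝ)) ^ n := by
  induction n generalizing f with
  | zero => exact ⟨0, le_rfl, fun l _ => by simp [mem_polyBelow_zero.1 hf]⟩
  | succ n ih =>
    choose C hC0 hC using fun s => ih (mem_polyBelow_succ.1 hf s)
    have hsum : 0 ≤ ∑ s ∈ S, C s := Finset.sum_nonneg fun s _ => hC0 s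
    have key : ∀ l : List G, (∀ s ∈ l, s ∈ S) →
        ‖f l.prod‖ ≤ ‖f 1‖ + l.length * ((∑ s ∈ S, C s) * (1 + (l.length : ℝ)) ^ n) := by
      intro l
      induction l with
      | nil => simp
      | cons a l ihl =>
        intro hl
        have ha : a ∈ S := hl a (by simp)
        have hl' : ∀ s ∈ l, s ∈ S := fun s hs => hl s (by simp [hs])
        have h1 := ihl hl'
        have h2 := hC a l hl'
        have h3 : C a ≤ ∑ s ∈ S, C s :=
          Finset.single_le_sum (f := C) (fun s _ => hC0 s) ha
        have h4 : f (a * l.prod) = leftDeriv a f l.prod + f l.prod := by simp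
        have h5 : (1 + (l.length : ℝ)) ^ n ≤ (1 + ((l.length : ℝ) + 1)) ^ n := by
          gcongr
          linarith
        have h6 : C a * (1 + (l.length : ℝ)) ^ n
            ≤ (∑ s ∈ S, C s) * (1 + ((l.length : ℝ) + 1)) ^ n := by gcongr
        have h7 : (l.length : ℝ) * ((∑ s ∈ S, C s) * (1 + (l.length : ℝ)) ^ n)
            ≤ l.length * ((∑ s ∈ S, C s) * (1 + ((l.length : ℝ) + 1)) ^ n) := by gcongr
        have h8 := norm_add_le (leftDeriv a f l.prod) (f l.prod)
        simp only [List.prod_cons, List.length_cons, Nat.cast_add, Nat.cast_one]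
        rw [h4]
        linarith
    refine ⟨‖f 1‖ + ∑ s ∈ S, C s, by positivity, fun l hl => (key l hl).trans ?_⟩
    have h1 : (1 : ℝ) ≤ (1 + (l.length : ℝ)) ^ (n + 1) :=
      one_le_pow₀ (le_add_of_nonneg_right (Nat.cast_nonneg _))
    have h2 : ‖f 1‖ ≤ ‖f 1‖ * (1 + (l.length : ℝ)) ^ (n + 1) :=
      le_mul_of_one_le_right (norm_nonneg _) h1
    have h3 : 0 ≤ (∑ s ∈ S, C s) * (1 + (l.length : ℝ)) ^ n := by positivity
    rw [pow_succ] at h2 ⊢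
    linarith

theorem exists_list_length_eq_wordLength {S : Finset G} (hS : IsSymmGeneratingSet S) (x : G) :
    ∃ l : List G, l.length = wordLength S x ∧ (∀ s ∈ l, s ∈ S) ∧ l.prod = x := by
  refine Nat.sInf_mem (s := {n : ℕ | ∃ l : List G, l.length = n ∧ (∀ s ∈ l, s ∈ S) ∧ l.prod = x})
    ?_
  have hx : x ∈ Subgroup.closure (S : Set G) := by simp [hS.closure_eq_top]
  rw [← Subgroup.mem_toSubmonoid, Subgroup.closure_toSubmonoid] at hx
  obtain ⟨l, hl, hp⟩ := Submonoid.exists_list_of_mem_closure hx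
  refine ⟨l.length, l, rfl, fun s hs => ?_, hp⟩
  rcases hl s hs with h | h
  · exact h
  · exact (hS.inv_mem_iff s).1 h

theorem summable_mul_of_mem_polyBelow {S : Finset G} (hS : IsSymmGeneratingSet S) {μ : PMF G}
    (hμ : StandingAssumptions S μ) {n : ℕ} {f : G → ℂ} (hf : f ∈ polyBelow G n) :
    Summable fun s => ((μ s).toReal : ℂ) * f s := by
  obtain ⟨C, hC0, hC⟩ := exists_bound_list_of_mem_polyBelow S n hf
  have hsum : Summable fun s : G => C * 2 ^ (n - 1) *
      ((μ s).toReal * (wordLength S s : ℝ) ^ 0 + (μ s).toReal * (wordLength S s : ℝ) ^ n) :=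
    ((hμ.finite_moments 0).add (hμ.finite_moments n)).mul_left _
  refine Summable.of_norm_bounded hsum fun s => ?_
  obtain ⟨l, hlen, hl, rfl⟩ := exists_list_length_eq_wordLength hS s
  have h1 := hC l hl
  rw [hlen] at h1
  have h2 := add_pow_le (zero_le_one (α := ℝ)) (Nat.cast_nonneg (wordLength S l.prod)) n
  rw [one_pow] at h2
  have h0 : 0 ≤ (μ l.prod).toReal := ENNReal.toReal_nonneg
  rw [norm_mul, Complex.norm_real, Real.norm_of_nonneg h0]
  calc (μ l.prod).toReal * ‖f l.prod‖
      ≤ (μ l.prod).toReal * (C * (2 ^ (n - 1) * (1 + (wordLength S l.prod : ℝ) ^ n))) := by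
        gcongr
        exact h1.trans (by gcongr)
    _ = _ := by ring

end Growth

/-! ### Averages over right translates -/

section Averages

variable {G : Type*} [Group G]

/-- The weight `w` is summable against every polynomial. -/
def PolySummable (w : G → ℂ) : Prop :=
  ∀ n : ℕ, ∀ f ∈ polyBelow G n, Summable fun s => w s * f s

/-- The weighted average `x ↦ ∑ s, w s * f (x * s)` of the right translates of `f`. -/
noncomputable def rightAverage (w : G → ℂ) (f : G → ℂ) : G → ℂ :=
  fun x => ∑' s : G, w s * f (x * s)

theorem PolySummable.summable_translate {w : G → ℂ} (hw : PolySummable w) {n : ℕ} {f : G → ℂ}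
    (hf : f ∈ polyBelow G n) (x : G) : Summable fun s => w s * f (x * s) :=
  hw n _ (leftTranslate_mem_polyBelow hf x)

theorem PolySummable.mul_hom_pow {w φ : G → ℂ} (hw : PolySummable w)
    (hφ : ∀ x y, φ (x * y) = φ x + φ y) (j : ℕ) : PolySummable fun s => w s * φ s ^ j := by
  intro n f hf
  have := hw _ _ (hom_pow_mul_mem_polyBelow hφ hf j)
  simpa [mul_assoc] using this

theorem leftDeriv_rightAverage {w : G → ℂ} (hw : PolySummable w) {n : ℕ} {f : G → ℂ}
    (hf : f ∈ polyBelow G n) (u : G) :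
    leftDeriv u (rightAverage w f) = rightAverage w (leftDeriv u f) := by
  funext x
  simp only [leftDeriv_apply, rightAverage]
  rw [← (hw.summable_translate hf (u * x)).tsum_sub (hw.summable_translate hf x)]
  simp only [mul_sub, mul_assoc]

theorem rightAverage_sub_mass_smul_mem {w : G → ℂ} (hw : PolySummable w) {n : ℕ} {f : G → ℂ}
    (hf : f ∈ polyBelow G (n + 1)) :
    rightAverage w f - (∑' s, w s) • f ∈ polyBelow G n := by
  induction n generalizing f with
  | zero =>
    refine mem_polyBelow_zero.2 ?_
    funext x
    have hc := eq_apply_one_of_mem_polyBelow_one hf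
    simp [rightAverage, hc x, hc (x * _), tsum_mul_right]
  | succ n ih =>
    refine mem_polyBelow_succ.2 fun u => ?_
    rw [map_sub, map_smul, leftDeriv_rightAverage hw hf]
    exact ih (mem_polyBelow_succ.1 hf u)

theorem rightAverage_mem_polyBelow {w : G → ℂ} (hw : PolySummable w) {n : ℕ} {f : G → ℂ}
    (hf : f ∈ polyBelow G (n + 1)) : rightAverage w f ∈ polyBelow G (n + 1) := by
  have h := add_mem (polyBelow_le_succ n (rightAverage_sub_mass_smul_mem hw hf))
    (Submodule.smul_mem _ (∑' s, w s) hf)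
  simpa using h

end Averages

/-! ### The Laplacian on polynomials -/

section Laplacian

variable {G : Type*} [Group G] {S : Finset G} {μ : PMF G}

theorem StandingAssumptions.polySummable (hS : IsSymmGeneratingSet S)
    (hμ : StandingAssumptions S μ) : PolySummable fun s => ((μ s).toReal : ℂ) :=
  fun _ _ hf => summable_mul_of_mem_polyBelow hS hμ hf

theorem PMF.hasSum_ofReal_toReal {α : Type*} (μ : PMF α) :
    HasSum (fun s => ((μ s).toReal : ℂ)) 1 := by
  have h := ENNReal.hasSum_toReal (f := μ) (by rw [μ.tsum_coe]; exact ENNReal.one_ne_top)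
  rw [← ENNReal.tsum_toReal_eq μ.apply_ne_top, μ.tsum_coe, ENNReal.toReal_one] at h
  simpa using Complex.hasSum_ofReal.2 h

theorem laplacian_summable (hS : IsSymmGeneratingSet S) (hμ : StandingAssumptions S μ) {n : ℕ}
    {f : G → ℂ} (hf : f ∈ polyBelow G n) (x : G) :
    Summable fun s : G => ((μ s).toReal : ℂ) * (f x - f (x * s)) := by
  simp only [mul_sub]
  exact (μ.hasSum_ofReal_toReal.summable.mul_right _).sub
    ((hμ.polySummable hS).summable_translate hf x)

theorem laplacian_eq_sub_rightAverage (hS : IsSymmGeneratingSet S) (hμ : StandingAssumptions S μ)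
    {n : ℕ} {f : G → ℂ} (hf : f ∈ polyBelow G n) :
    laplacian μ f = f - rightAverage (fun s => ((μ s).toReal : ℂ)) f := by
  funext x
  simp only [laplacian, mul_sub, Pi.sub_apply, rightAverage]
  rw [(μ.hasSum_ofReal_toReal.summable.mul_right _).tsum_sub
    ((hμ.polySummable hS).summable_translate hf x), tsum_mul_right,
    μ.hasSum_ofReal_toReal.tsum_eq, one_mul]

theorem leftDeriv_laplacian (hS : IsSymmGeneratingSet S) (hμ : StandingAssumptions S μ)
    {n : ℕ} {f : G → ℂ} (hf : f ∈ polyBelow G n) (u : G) :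
    leftDeriv u (laplacian μ f) = laplacian μ (leftDeriv u f) := by
  rw [laplacian_eq_sub_rightAverage hS hμ hf, map_sub,
    leftDeriv_rightAverage (hμ.polySummable hS) hf,
    laplacian_eq_sub_rightAverage hS hμ (leftDeriv_mem_polyBelow hf u)]

/-- A symmetric probability measure gives mass zero to an odd weight. -/
theorem StandingAssumptions.tsum_mul_eq_zero_of_odd (hμ : StandingAssumptions S μ) {g : G → ℂ}
    (hg : ∀ s, g s⁻¹ = -g s) : ∑' s, ((μ s).toReal : ℂ) * g s = 0 := by
  have h := (Equiv.inv G).tsum_eq fun s => ((μ s).toReal : ℂ) * g s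
  simp only [Equiv.inv_apply, hμ.symmetric, hg, mul_neg, tsum_neg] at h
  exact self_eq_neg.1 h.symm

theorem laplacian_eq_zero_of_mem_polyBelow_two (hS : IsSymmGeneratingSet S)
    (hμ : StandingAssumptions S μ) {f : G → ℂ} (hf : f ∈ polyBelow G 2) : laplacian μ f = 0 := by
  have h1 : laplacian μ f ∈ polyBelow G 1 := by
    rw [← neg_mem_iff, laplacian_eq_sub_rightAverage hS hμ hf, neg_sub]
    have := rightAverage_sub_mass_smul_mem (hμ.polySummable hS) hf
    rwa [μ.hasSum_ofReal_toReal.tsum_eq, one_smul] at this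
  funext x
  rw [eq_apply_one_of_mem_polyBelow_one h1 x]
  simp only [laplacian, one_mul]
  exact hμ.tsum_mul_eq_zero_of_odd (apply_inv_sub_of_mem_polyBelow_two hf)

theorem laplacian_mem_polyBelow (hS : IsSymmGeneratingSet S) (hμ : StandingAssumptions S μ)
    {n : ℕ} {f : G → ℂ} (hf : f ∈ polyBelow G (n + 2)) : laplacian μ f ∈ polyBelow G n := by
  induction n generalizing f with
  | zero => exact mem_polyBelow_zero.2 (laplacian_eq_zero_of_mem_polyBelow_two hS hμ hf)
  | succ n ih =>
    refine mem_polyBelow_succ.2 fun u => ?_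
    rw [leftDeriv_laplacian hS hμ hf]
    exact ih (mem_polyBelow_succ.1 hf u)

theorem laplacian_add (hS : IsSymmGeneratingSet S) (hμ : StandingAssumptions S μ) {n : ℕ}
    {f g : G → ℂ} (hf : f ∈ polyBelow G n) (hg : g ∈ polyBelow G n) :
    laplacian μ (f + g) = laplacian μ f + laplacian μ g := by
  funext x
  simp only [laplacian, Pi.add_apply]
  rw [← (laplacian_summable hS hμ hf x).tsum_add (laplacian_summable hS hμ hg x)]
  refine tsum_congr fun s => ?_
  ring

theorem laplacian_smul (c : ℂ) (f : G → ℂ) : laplacian μ (c • f) = c • laplacian μ f := by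
  funext x
  simp only [laplacian, Pi.smul_apply, smul_eq_mul, ← tsum_mul_left]
  refine tsum_congr fun s => ?_
  ring

/-- The image of `polyBelow G n` under the Laplacian. The Laplacian is additive only on functions
for which its series converges, so this is not literally a `Submodule.map`. -/
noncomputable def laplacianImage (hS : IsSymmGeneratingSet S) (hμ : StandingAssumptions S μ)
    (n : ℕ) : Submodule ℂ (G → ℂ) where
  carrier := laplacian μ '' (polyBelow G n : Set (G → ℂ))
  zero_mem' := ⟨0, zero_mem _, by funext x; simp [laplacian]⟩
  add_mem' := by
    rintro _ _ ⟨f, hf, rfl⟩ ⟨g, hg, rfl⟩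
    exact ⟨f + g, add_mem hf hg, laplacian_add hS hμ hf hg⟩
  smul_mem' := by
    rintro c _ ⟨f, hf, rfl⟩
    exact ⟨c • f, Submodule.smul_mem _ c hf, laplacian_smul c f⟩

/-! ### Surjectivity -/

/-- The binomial expansion of `Δ (φ ^ N * f)` in terms of the averages with weights `μ φ ^ j`. -/
theorem laplacian_hom_pow_mul (hS : IsSymmGeneratingSet S) (hμ : StandingAssumptions S μ)
    {φ : G → ℂ} (hφ : ∀ x y, φ (x * y) = φ x + φ y) {n : ℕ} {f : G → ℂ}
    (hf : f ∈ polyBelow G n) (N : ℕ) :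
    laplacian μ (φ ^ N * f) = φ ^ N * f - ∑ m ∈ Finset.range (N + 1),
      (N.choose m : ℂ) • (φ ^ m *
        rightAverage (fun s => ((μ s).toReal : ℂ) * φ s ^ (N - m)) f) := by
  rw [laplacian_eq_sub_rightAverage hS hμ (hom_pow_mul_mem_polyBelow hφ hf N)]
  congr 1
  funext x
  simp only [rightAverage, Pi.mul_apply, Pi.pow_apply, hφ, add_pow, Finset.sum_apply,
    Pi.smul_apply, smul_eq_mul, Finset.sum_mul, Finset.mul_sum, ← tsum_mul_left]
  have hsum : ∀ m ∈ Finset.range (N + 1), Summable fun s =>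
      (N.choose m : ℂ) * (φ x ^ m * (((μ s).toReal : ℂ) * φ s ^ (N - m) * f (x * s))) :=
    fun m _ => ((((hμ.polySummable hS).mul_hom_pow hφ (N - m)).summable_translate hf
      x).mul_left _).mul_left _
  rw [← Summable.tsum_finsetSum hsum]
  refine tsum_congr fun s => Finset.sum_congr rfl fun m _ => ?_
  ring

/-- The downward induction on the power of `φ`, written as an induction on the complementary
degree `e`: every multiple `φ ^ d * f` of total degree at most `n` is in the image of the
Laplacian, provided this holds for all polynomials of degree less than `n`. -/
theorem pow_mul_mem_laplacianImage (hS : IsSymmGeneratingSet S) (hμ : StandingAssumptions S μ)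
    {φ : G → ℂ} (hφ : ∀ x y, φ (x * y) = φ x + φ y)
    (hvar : ∑' s, ((μ s).toReal : ℂ) * φ s ^ 2 ≠ 0) {n : ℕ}
    (hn : polyBelow G n ≤ laplacianImage hS hμ (n + 3)) (e d : ℕ) (hde : d + e = n + 1)
    {f : G → ℂ} (hf : f ∈ polyBelow G e) : φ ^ d * f ∈ laplacianImage hS hμ (n + 3) := by
  induction e generalizing d f with
  | zero =>
    rw [mem_polyBelow_zero.1 hf, mul_zero]
    exact zero_mem _
  | succ e ih =>
    set T := laplacianImage hS hμ (n + 3)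
    set M : ℕ → G → ℂ := fun j => rightAverage (fun s => ((μ s).toReal : ℂ) * φ s ^ j) f
    have hw := fun j => (hμ.polySummable hS).mul_hom_pow hφ j
    have hlow : ∀ {m : ℕ} {g : G → ℂ}, m ≤ n → g ∈ polyBelow G m → g ∈ T :=
      fun hm hg => hn (polyBelow_mono hm hg)
    have hleft : laplacian μ (φ ^ (d + 2) * f) ∈ T :=
      ⟨_, polyBelow_mono (by omega) (hom_pow_mul_mem_polyBelow hφ hf (d + 2)), rfl⟩
    -- the summand of index `m` carries the average with weight `μ φ ^ (d + 2 - m)`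
    rw [laplacian_hom_pow_mul hS hμ hφ hf, Finset.sum_range_succ, Finset.sum_range_succ,
      Finset.sum_range_succ] at hleft
    have hrest : ∑ m ∈ Finset.range d, ((d + 2).choose m : ℂ) • (φ ^ m * M (d + 2 - m)) ∈ T := by
      refine sum_mem fun m hm => Submodule.smul_mem _ _ ?_
      have hm' := Finset.mem_range.1 hm
      exact hlow (by omega)
        (hom_pow_mul_mem_polyBelow hφ (rightAverage_mem_polyBelow (hw (d + 2 - m)) hf) m)
    have hzero : φ ^ (d + 2) * (f - M 0) ∈ T := by
      have hM0 : f - M 0 = laplacian μ f := by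
        simp [M, laplacian_eq_sub_rightAverage hS hμ hf]
      have hlap : φ * laplacian μ f ∈ polyBelow G e := by
        cases e with
        | zero =>
          rw [laplacian_eq_zero_of_mem_polyBelow_two hS hμ (polyBelow_le_succ 1 hf), mul_zero]
          exact zero_mem _
        | succ e => exact hom_mul_mem_polyBelow hφ (laplacian_mem_polyBelow hS hμ hf)
      rw [hM0, pow_succ, mul_assoc]
      exact ih (d + 1) (by omega) hlap
    have hone : φ ^ (d + 1) * M 1 ∈ T := by
      have h := rightAverage_sub_mass_smul_mem (hw 1) hf
      have hodd : ∀ s, φ s⁻¹ = -φ s := fun s => by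
        have h1 : φ 1 = 0 := by simpa using hφ 1 1
        have h2 := hφ s⁻¹ s
        rw [inv_mul_cancel, h1] at h2
        linear_combination -h2
      have hmass : ∑' s, ((μ s).toReal : ℂ) * φ s ^ 1 = 0 := by
        simpa using hμ.tsum_mul_eq_zero_of_odd hodd
      rw [hmass, zero_smul, sub_zero] at h
      exact ih (d + 1) (by omega) h
    have htwo : φ ^ d * (M 2 - (∑' s, ((μ s).toReal : ℂ) * φ s ^ 2) • f) ∈ T :=
      hlow (by omega) (hom_pow_mul_mem_polyBelow hφ (rightAverage_sub_mass_smul_mem (hw 2) hf) d)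
    set σ : ℂ := ∑' s, ((μ s).toReal : ℂ) * φ s ^ 2
    have hc : (((d + 2).choose d : ℕ) : ℂ) * σ ≠ 0 :=
      mul_ne_zero (Nat.cast_ne_zero.2 (Nat.choose_pos (by omega)).ne') hvar
    have hid : (((d + 2).choose d : ℂ) * σ) • (φ ^ d * f) =
        φ ^ (d + 2) * (f - M 0) - ((d + 2).choose (d + 1) : ℂ) • (φ ^ (d + 1) * M 1)
          - ((d + 2).choose d : ℂ) • (φ ^ d * (M 2 - σ • f))
          - ∑ m ∈ Finset.range d, ((d + 2).choose m : ℂ) • (φ ^ m * M (d + 2 - m))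
          - (φ ^ (d + 2) * f -
            (∑ m ∈ Finset.range d, ((d + 2).choose m : ℂ) • (φ ^ m * M (d + 2 - m))
              + ((d + 2).choose d : ℂ) • (φ ^ d * M (d + 2 - d))
              + ((d + 2).choose (d + 1) : ℂ) • (φ ^ (d + 1) * M (d + 2 - (d + 1)))
              + ((d + 2).choose (d + 2) : ℂ) • (φ ^ (d + 2) * M (d + 2 - (d + 2))))) := by
      rw [show d + 2 - d = 2 by omega, show d + 2 - (d + 1) = 1 by omega, Nat.sub_self,
        Nat.choose_self]
      funext x
      simp only [Pi.smul_apply, Pi.mul_apply, Pi.sub_apply, Pi.add_apply, smul_eq_mul,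
        Nat.cast_one]
      ring
    rw [← T.smul_mem_iff hc, hid]
    exact T.sub_mem (T.sub_mem (T.sub_mem (T.sub_mem hzero (T.smul_mem _ hone))
      (T.smul_mem _ htwo)) hrest) hleft

theorem polyBelow_le_laplacianImage (hS : IsSymmGeneratingSet S) (hμ : StandingAssumptions S μ)
    {φ : G → ℂ} (hφ : ∀ x y, φ (x * y) = φ x + φ y)
    (hvar : ∑' s, ((μ s).toReal : ℂ) * φ s ^ 2 ≠ 0) (n : ℕ) :
    polyBelow G n ≤ laplacianImage hS hμ (n + 2) := by
  induction n with
  | zero => exact bot_le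
  | succ n ih =>
    intro f hf
    have hn : polyBelow G n ≤ laplacianImage hS hμ (n + 3) :=
      ih.trans (Set.image_mono (polyBelow_le_succ (n + 2)))
    simpa using pow_mul_mem_laplacianImage hS hμ hφ hvar hn (n + 1) 0 (by omega) hf

end Laplacian

/-! ### A homomorphism to the integers with nonzero variance -/

section Homomorphism

variable {G : Type*} [Group G]

open scoped DirectSum in
theorem exists_addMonoidHom_int_ne_zero (A : Type*) [AddCommGroup A] [AddGroup.FG A]
    [Infinite A] : ∃ φ : A →+ ℤ, φ ≠ 0 := by
  obtain ⟨n, ι, _, p, hp, e, ⟨g⟩⟩ := AddCommGroup.equiv_free_prod_directSum_zmod A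
  have : ∀ i, NeZero (p i ^ e i) := fun i => ⟨pow_ne_zero _ (hp i).ne_zero⟩
  -- without a free part the group would be a finite sum of finite groups
  have hn : n ≠ 0 := by
    rintro rfl
    have : Finite (⨁ i : ι, ZMod (p i ^ e i)) :=
      Finite.of_injective _ (DirectSum.addEquivProd fun i => ZMod (p i ^ e i)).injective
    exact not_finite_iff_infinite.2 ‹Infinite A› (Finite.of_injective _ g.injective)
  let i : Fin n := ⟨0, Nat.pos_of_ne_zero hn⟩
  refine ⟨((Finsupp.applyAddHom i).comp (AddMonoidHom.fst _ _)).comp g.toAddMonoidHom,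
    fun h => ?_⟩
  have h1 := DFunLike.congr_fun h (g.symm (Finsupp.single i 1, 0))
  simp at h1

theorem exists_hom_int_ne_zero {S : Finset G} (hS : IsSymmGeneratingSet S)
    [Infinite (Abelianization G)] :
    ∃ φ : G → ℤ, (∀ x y, φ (x * y) = φ x + φ y) ∧ ∃ x, φ x ≠ 0 := by
  have : Group.FG G := ⟨⟨S, hS.closure_eq_top⟩⟩
  have : Group.FG (Abelianization G) :=
    Group.fg_of_surjective (f := Abelianization.of) QuotientGroup.mk_surjective
  obtain ⟨φ, hφ⟩ := exists_addMonoidHom_int_ne_zero (Additive (Abelianization G))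
  refine ⟨fun x => φ (Additive.ofMul (Abelianization.of x)), fun x y => by simp, ?_⟩
  by_contra! h
  refine hφ (AddMonoidHom.ext fun a => ?_)
  obtain ⟨x, hx⟩ := QuotientGroup.mk_surjective a.toMul
  have ha : a = Additive.ofMul (Abelianization.of x) := congrArg Additive.ofMul hx.symm
  rw [ha]
  exact h x

theorem variance_ne_zero {S : Finset G} (hS : IsSymmGeneratingSet S) {μ : PMF G}
    (hμ : StandingAssumptions S μ) {φ : G → ℤ} (hφ : ∀ x y, φ (x * y) = φ x + φ y)
    (hne : ∃ x, φ x ≠ 0) : ∑' s, ((μ s).toReal : ℂ) * (φ s : ℂ) ^ 2 ≠ 0 := by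
  let Φ : G →* Multiplicative ℤ := MonoidHom.mk' (fun x => Multiplicative.ofAdd (φ x)) fun x y => by
    simp [hφ]
  have hs : ∃ s ∈ μ.support, φ s ≠ 0 := by
    by_contra! h
    have hle : Subgroup.closure μ.support ≤ Φ.ker := by
      rw [Subgroup.closure_le]
      intro s hs
      simp [Φ, MonoidHom.mem_ker, h s hs]
    obtain ⟨x, hx⟩ := hne
    rw [hμ.adapted] at hle
    have := hle (Subgroup.mem_top x)
    exact hx (by simpa [Φ, MonoidHom.mem_ker] using this)
  obtain ⟨s, hs, hs'⟩ := hs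
  have hsum : Summable fun s => (μ s).toReal * (φ s : ℝ) ^ 2 := by
    have h := (hμ.polySummable hS).mul_hom_pow (φ := fun x => (φ x : ℂ))
      (fun x y => by simp [hφ]) 2 1 1 (mem_polyBelow_one_of_const fun _ => rfl)
    rw [← Complex.summable_ofReal]
    simpa using h
  have hpos : 0 < ∑' s, (μ s).toReal * (φ s : ℝ) ^ 2 := by
    refine hsum.tsum_pos (fun t => by positivity) s ?_
    have h1 : 0 < (μ s).toReal := ENNReal.toReal_pos hs (μ.apply_ne_top s)
    have h2 : (φ s : ℝ) ≠ 0 := Int.cast_ne_zero.2 hs'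
    positivity
  have hcast : ∑' s, ((μ s).toReal : ℂ) * (φ s : ℂ) ^ 2
      = ((∑' s, (μ s).toReal * (φ s : ℝ) ^ 2 : ℝ) : ℂ) := by
    rw [Complex.ofReal_tsum]
    simp
  rw [hcast]
  exact_mod_cast hpos.ne'

end Homomorphism

theorem mainTheorem2 {G : Type*} [Group G] (S : Finset G) (hS : IsSymmGeneratingSet S)
    (μ : PMF G) (hμ : StandingAssumptions S μ) (k : ℕ) :
    (∀ f ∈ polySpace G (k : ℤ), ∀ x : G,
      Summable fun s : G => ((μ s).toReal : ℂ) * (f x - f (x * s))) ∧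
    laplacian μ '' (polySpace G (k : ℤ) : Set (G → ℂ)) ⊆ (polySpace G ((k : ℤ) - 2) : Set (G → ℂ)) ∧
    (k ≤ 1 ∨ Infinite (Abelianization G) →
      laplacian μ '' (polySpace G (k : ℤ) : Set (G → ℂ)) =
        (polySpace G ((k : ℤ) - 2) : Set (G → ℂ))) := by
  -- truncated subtraction: for `k ≤ 1` both sides are the zero space
  have htarget : polySpace G ((k : ℤ) - 2) = polyBelow G (k - 1) := by
    match k with
    | 0 => rfl
    | 1 => rfl
    | k + 2 =>
      rw [show ((k + 2 : ℕ) : ℤ) - 2 = (k : ℤ) by push_cast; ring]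
      exact polySpace_natCast k
  rw [htarget, polySpace_natCast]
  have hsub : laplacian μ '' (polyBelow G (k + 1) : Set (G → ℂ)) ⊆ polyBelow G (k - 1) := by
    rintro _ ⟨f, hf, rfl⟩
    exact laplacian_mem_polyBelow hS hμ (polyBelow_mono (by omega) hf)
  refine ⟨fun f hf => laplacian_summable hS hμ hf, hsub, fun h => hsub.antisymm ?_⟩
  by_cases hk : k ≤ 1
  · rw [Nat.sub_eq_zero_of_le hk]
    exact (bot_le : polyBelow G 0 ≤ laplacianImage hS hμ (k + 1))
  · have : Infinite (Abelianization G) := h.resolve_left hk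
    obtain ⟨φ, hφ, hne⟩ := exists_hom_int_ne_zero hS
    have hle := polyBelow_le_laplacianImage hS hμ (φ := fun x => (φ x : ℂ))
      (fun x y => by simp [hφ]) (variance_ne_zero hS hμ hφ hne) (k - 1)
    rwa [show k - 1 + 2 = k + 1 by omega] at hle
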